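/- Let $M\ge 0$ be an integer and let $q\ge 3$, $c>0$, $\sigma_{\min}>0$, $C\ge 1$ be real numbers. Let $\mathcal D(M,q,c,\sigma_{\min},C)$ be the class of all sequences $(X_i)_{i\ge 1}$ of real random variables on a probability space, with means $\mu_i:=\mathbb E[X_i]$, such that - the sequence is $M$-dependent, i.e. for every $k\ge 1$ the families $(X_i)_{i\le k}$ and $(X_i)_{i\ge k+M+1}$ are independent; - each $X_i$ is absolutely continuous with a probability density bounded by $c$ (almost everywhere); - $\mathbb E|X_i|^q\le C$ and $\mathbb E|X_i-\mu_i|^q\le C$ for all $i$; - the standard deviation of each $X_i$ is at least $\sigma_{\min}$. For $p\ge 1$ put $\mathbf X:=(X_1,\dots,X_p)$ and $\boldsymbol\mu:=(\mu_1,\dots,\mu_p)$. A geometric median of $\mathbf X$ is a vector $\mathbf m\in\mathbb R^p$ that minimizes $\mathbf m\mapsto\mathbb E\|\mathbf X-\mathbf m\|$, where $\|\cdot\|$ is the Euclidean norm. **Theorem.** There is a constant $B_3$, depending only on $M,q,c,\sigma_{\min},C$, such that for every sequence $(X_i)_{i\ge1}\in\mathcal D(M,q,c,\sigma_{\min},C)$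 and every integer $p\ge 1$: a geometric median of $\mathbf X$ exists, it is unique if $p\ge M+2$, and every geometric median $\mathbf m_p=(m_{p,1},\dots,m_{p,p})$ of $\mathbf X$ satisfies $$|m_{p,i}-\mu_i|\le \frac{B_3}{p}\qquad\text{for all } 1\le i\le p .$$ In particular, $\|\mathbf m_p-\boldsymbol\mu\|\le B_3/\sqrt p$. -/

import Mathlib

open MeasureTheory ProbabilityTheory

/-- `M`-dependence of a sequence `X 0, X 1, X 2, …` of random variables: for every `k`, the families
`(X i)_{i ≤ k}` and `(X i)_{i ≥ k + M + 1}` are independent. -/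
def MDependent {Ω : Type*} [MeasurableSpace Ω] (P : Measure Ω) (M : ℕ) (X : ℕ → Ω → ℝ) : Prop :=
  ∀ k : ℕ, IndepFun (fun ω (i : Set.Iic k) => X i ω) (fun ω (i : Set.Ici (k + M + 1)) => X i ω) P

/-- The class `𝒟(M, q, c, σ_min, C)` of sequences of real random variables. -/
structure InClassD {Ω : Type*} [MeasurableSpace Ω] (P : Measure Ω)
    (M : ℕ) (q c σmin C : ℝ) (X : ℕ → Ω → ℝ) : Prop where
  measurable : ∀ i, Measurable (X i)
  mDependent : MDependent P M X
  /-- each law is absolutely continuous with respect to Lebesgue measure -/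
  hasPDF : ∀ i, HasPDF (X i) P volume
  /-- each density is bounded by `c` (almost everywhere, densities being a.e. classes) -/
  pdf_le : ∀ i, ∀ᵐ x ∂(volume : Measure ℝ), pdf (X i) P volume x ≤ ENNReal.ofReal c
  integrable_moment : ∀ i, Integrable (fun ω => |X i ω| ^ q) P
  moment_le : ∀ i, ∫ ω, |X i ω| ^ q ∂P ≤ C
  integrable_centered_moment : ∀ i, Integrable (fun ω => |X i ω - ∫ ω', X i ω' ∂P| ^ q) P
  centered_moment_le : ∀ i, ∫ ω, |X i ω - ∫ ω', X i ω' ∂P| ^ q ∂P ≤ C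
  le_sd : ∀ i, σmin ≤ Real.sqrt (variance (X i) P)

/-- The random vector consisting of the first `p` terms of the sequence, in Euclidean space. -/
def firstTerms {Ω : Type*} (X : ℕ → Ω → ℝ) (p : ℕ) (ω : Ω) : EuclideanSpace ℝ (Fin p) :=
  WithLp.toLp 2 (fun i : Fin p => X i ω)

/-- The vector of expectations of the first `p` terms of the sequence. -/
noncomputable def meanVector {Ω : Type*} [MeasurableSpace Ω] (P : Measure Ω) (X : ℕ → Ω → ℝ)
    (p : ℕ) : EuclideanSpace ℝ (Fin p) :=
  WithLp.toLp 2 (fun i : Fin p => ∫ ω, X i ω ∂P)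

/-- `m` is a geometric median of the (integrable) random vector `Y`: it minimizes `𝔼 ‖Y - m‖`. -/
def IsGeometricMedian {Ω : Type*} [MeasurableSpace Ω] (P : Measure Ω) {p : ℕ}
    (Y : Ω → EuclideanSpace ℝ (Fin p)) (m : EuclideanSpace ℝ (Fin p)) : Prop :=
  ∀ v : EuclideanSpace ℝ (Fin p), ∫ ω, ‖Y ω - m‖ ∂P ≤ ∫ ω, ‖Y ω - v‖ ∂P

/-!
Write `μ i` for the mean of `X i`, `Y i = X i - μ i`, and `R = ‖X - m‖` for a geometric median `m`.
The expected distance is convex, Lipschitz and coercive, so a median exists; it is unique as soon as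
the law of `X` charges no line, which independence of `X 0` and `X (M + 1)` ensures when
`p ≥ M + 2` (`InClassD.ae_not_sameRay`).

For the estimate, the first-order condition `𝔼 [(X i - m i) / R] = 0` reads
`(m i - μ i) 𝔼 [1 / R] = 𝔼 [Y i / R]`. Since `𝔼 R` is at most of order `√p`, Jensen's inequality
bounds `𝔼 [1 / R]` below by a multiple of `1 / √p`, so it suffices that `𝔼 [Y i / R]` is of order
`p ^ (-3/2)`. Let `R'` be the distance in the coordinates at index distance more than `M` from `i`.
It is independent of `X i` (`MDependent.indepFun_apply_of_dependsOn`), so `𝔼 [Y i / R'] = 0`, and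
`|1 / R' - 1 / R| ≤ D / R' ^ 3`, where `D` collects the squares of the at most `2 M + 1` remaining
coordinates. To decouple `D` from `R'`, bound `1 / R'` by the inverse distance `W` along
coordinates spaced by `M + 1` on one side of `i`, at index distance more than `2 M`
(`InClassD.exists_dominating_inv_dist`). Then `𝔼 [|Y i| D W ^ 3] = 𝔼 [|Y i| D] 𝔼 [W ^ 3]`, where
the second factor is of order `p ^ (-3/2)` and the first is a third-order moment, bounded once
`|m j - μ j|` is known to be bounded (`InClassD.abs_sub_mean_le`, `InClassD.abs_sub_mean_le_div`).

The bound on `𝔼 [W ^ 3]` uses the densities only. For `n` independent `Z k`, the inequality of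
arithmetic and geometric means gives
`(∑ Z k ^ 2) ^ (-3/2) ≤ n ^ (-3/2) ∏ |Z k| ^ (-3/n)`, and by Jensen's inequality the expectation of
the product is at most `K ^ 6` when `n ≥ 6`, with `K` a bound for `𝔼 |Z k| ^ (-1/2)`
(`InClassD.lintegral_inv_sqrt_sum_sq_pow_three_le`).
-/

/-! ### Independence -/

/-- The hypotheses make the law of `(L, X, R)` a product of three laws, which allows regrouping. -/
lemma indepFun_prodMk_of_indepFun_prodMk {Ω α β γ : Type*} [MeasurableSpace Ω] [MeasurableSpace α]
    [MeasurableSpace β] [MeasurableSpace γ] {P : Measure Ω} [IsProbabilityMeasure P]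
    {L : Ω → α} {X : Ω → β} {R : Ω → γ} (hL : Measurable L) (hX : Measurable X) (hR : Measurable R)
    (hLX : IndepFun L X P) (hLXR : IndepFun (fun ω => (L ω, X ω)) R P) :
    IndepFun X (fun ω => (L ω, R ω)) P := by
  have hLR : IndepFun L R P := hLXR.comp (φ := Prod.fst) (ψ := id) measurable_fst measurable_id
  have := Measure.isProbabilityMeasure_map hL.aemeasurable (μ := P)
  have := Measure.isProbabilityMeasure_map hX.aemeasurable (μ := P)
  have := Measure.isProbabilityMeasure_map hR.aemeasurable (μ := P)
  rw [indepFun_iff_map_prod_eq_prod_map_map hX.aemeasurable (hL.prodMk hR).aemeasurable]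
  have e1 := (indepFun_iff_map_prod_eq_prod_map_map (hL.prodMk hX).aemeasurable
    hR.aemeasurable).1 hLXR
  have e2 := (indepFun_iff_map_prod_eq_prod_map_map hL.aemeasurable hX.aemeasurable).1 hLX
  have e3 := (indepFun_iff_map_prod_eq_prod_map_map hL.aemeasurable hR.aemeasurable).1 hLR
  have hm : Measurable (fun z : (α × β) × γ => (z.1.2, (z.1.1, z.2))) := by fun_prop
  have e4 : P.map (fun ω => (X ω, (L ω, R ω)))
      = (P.map (fun ω => ((L ω, X ω), R ω))).map (fun z => (z.1.2, (z.1.1, z.2))) := by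
    rw [Measure.map_map hm (by fun_prop)]; rfl
  have e5 : (fun z : (α × β) × γ => (z.1.2, (z.1.1, z.2)))
      = MeasurableEquiv.prodAssoc ∘ Prod.map Prod.swap id := rfl
  rw [e4, e1, e2, e3, e5, ← Measure.map_map (MeasurableEquiv.measurable _)
    (measurable_swap.prodMap measurable_id), ← Measure.map_prod_map _ _ measurable_swap
    measurable_id, Measure.prod_swap, Measure.map_id, Measure.prodAssoc_prod]

/-- `M`-dependence for functions of the whole sequence that depend only on the terms up to `k`,
respectively from `k + M + 1` on. This form avoids functions on subtypes of indices. -/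
lemma MDependent.indepFun_of_dependsOn {Ω β γ : Type*} [MeasurableSpace Ω] [MeasurableSpace β]
    [MeasurableSpace γ] {P : Measure Ω} {M : ℕ} {X : ℕ → Ω → ℝ} (h : MDependent P M X) (k : ℕ)
    {φ : (ℕ → ℝ) → β} {ψ : (ℕ → ℝ) → γ} (hφ : Measurable φ) (hψ : Measurable ψ)
    (dφ : DependsOn φ (Set.Iic k)) (dψ : DependsOn ψ (Set.Ici (k + M + 1))) :
    IndepFun (fun ω => φ (fun j => X j ω)) (fun ω => ψ (fun j => X j ω)) P := by
  classical
  -- Each function is applied to the restricted family continued by zeros.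
  let ext (I : Set ℕ) (y : I → ℝ) (j : ℕ) : ℝ := if h : j ∈ I then y ⟨j, h⟩ else 0
  have hext (I : Set ℕ) : Measurable (ext I) := by
    refine measurable_pi_iff.2 fun j => ?_
    by_cases hj : j ∈ I
    · simpa [ext, hj] using measurable_pi_apply _
    · simp [ext, hj]
  have key := (h k).comp (hφ.comp (hext _)) (hψ.comp (hext _))
  convert key using 1
  · funext ω
    exact dφ fun i hi => by simp only [ext, dif_pos hi]
  · funext ω
    exact dψ fun i hi => by simp only [ext, dif_pos hi]

/-- Each term of an `M`-dependent sequence is independent of the terms at distance more than `M`,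
on both sides jointly. -/
lemma MDependent.indepFun_apply_of_dependsOn {Ω γ : Type*} [MeasurableSpace Ω]
    [MeasurableSpace γ] {P : Measure Ω} [IsProbabilityMeasure P] {M : ℕ} {X : ℕ → Ω → ℝ}
    (h : MDependent P M X) (hX : ∀ i, Measurable (X i)) (i : ℕ)
    {ψ : (ℕ → ℝ) → γ} (hψ : Measurable ψ)
    (dψ : DependsOn ψ {j | j + M < i ∨ i + M < j}) :
    IndepFun (X i) (fun ω => ψ (fun j => X j ω)) P := by
  -- The sequence is split into its parts left and right of `i`; their sum determines `ψ`.
  let l (x : ℕ → ℝ) (j : ℕ) : ℝ := if j + M < i then x j else 0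
  let r (x : ℕ → ℝ) (j : ℕ) : ℝ := if i + M < j then x j else 0
  have hl : Measurable l := by
    refine measurable_pi_iff.2 fun j => ?_
    by_cases hj : j + M < i <;> simp only [l, hj, if_true, if_false] <;> fun_prop
  have hr : Measurable r := by
    refine measurable_pi_iff.2 fun j => ?_
    by_cases hj : i + M < j <;> simp only [r, hj, if_true, if_false] <;> fun_prop
  have dr : DependsOn r (Set.Ici (i + M + 1)) := by
    intro x y hxy
    funext j
    by_cases hj : i + M < j
    · simp only [r, hj, if_true]; exact hxy j (by simp; omega)
    · simp only [r, hj, if_false]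
  have hseq : Measurable (fun ω (j : ℕ) => X j ω) := measurable_pi_iff.2 hX
  have h1 : IndepFun (fun ω => l (fun j => X j ω)) (X i) P := by
    by_cases hi : M + 1 ≤ i
    · refine h.indepFun_of_dependsOn (i - (M + 1)) (φ := l) (ψ := fun x => x i) hl
        (measurable_pi_apply i) ?_ ?_
      · intro x y hxy
        funext j
        by_cases hj : j + M < i
        · simp only [l, hj, if_true]; exact hxy j (by simp; omega)
        · simp only [l, hj, if_false]
      · exact fun x y hxy => hxy i (by simp; omega)
    · have : (fun ω => l (fun j => X j ω)) = fun _ => (fun _ => 0) := by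
        funext ω j
        exact if_neg (by omega)
      rw [this]
      exact indepFun_const_left _ _
  have h2 : IndepFun (fun ω => (l (fun j => X j ω), X i ω)) (fun ω => r (fun j => X j ω)) P := by
    refine h.indepFun_of_dependsOn i (φ := fun x => (l x, x i)) (ψ := r)
      (hl.prodMk (measurable_pi_apply i)) hr ?_ dr
    intro x y hxy
    refine Prod.ext (funext fun j => ?_) (hxy i (by simp))
    by_cases hj : j + M < i
    · simp only [l, hj, if_true]; exact hxy j (by simp; omega)
    · simp only [l, hj, if_false]
  have h3 := indepFun_prodMk_of_indepFun_prodMk (hl.comp hseq) (hX i) (hr.comp hseq) h1 h2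
  have h4 := h3.comp (φ := id) (ψ := fun z => ψ (z.1 + z.2)) measurable_id (by fun_prop)
  convert h4 using 1
  · rfl
  funext ω
  refine dψ fun j hj => ?_
  rcases hj with hj | hj
  · have : ¬ i + M < j := by omega
    simp [l, r, hj, this]
  · have : ¬ j + M < i := by omega
    simp [l, r, hj, this]

/-- Terms at indices spaced by `M + 1` are independent, in the form of a product formula. -/
lemma MDependent.lintegral_prod_spaced {Ω : Type*} [MeasurableSpace Ω] {P : Measure Ω}
    [IsProbabilityMeasure P] {M : ℕ} {X : ℕ → Ω → ℝ}
    (h : MDependent P M X) (hX : ∀ i, Measurable (X i)) (g : ℕ → ℝ → ENNReal)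
    (hg : ∀ k, Measurable (g k)) (a n : ℕ) :
    ∫⁻ ω, ∏ k ∈ Finset.range n, g k (X (a + k * (M + 1)) ω) ∂P
      = ∏ k ∈ Finset.range n, ∫⁻ ω, g k (X (a + k * (M + 1)) ω) ∂P := by
  induction n with
  | zero => simp
  | succ n ih =>
    rcases n with _ | n
    · simp
    rw [Finset.prod_range_succ, ← ih]
    simp_rw [Finset.prod_range_succ _ (n + 1)]
    refine lintegral_mul_eq_lintegral_mul_lintegral_of_indepFun''
      (f := fun ω => ∏ k ∈ Finset.range (n + 1), g k (X (a + k * (M + 1)) ω))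
      (Finset.measurable_prod _ fun k _ => (hg k).comp (hX _)).aemeasurable
      ((hg _).comp (hX _)).aemeasurable ?_
    refine h.indepFun_of_dependsOn (a + n * (M + 1))
      (φ := fun x => ∏ k ∈ Finset.range (n + 1), g k (x (a + k * (M + 1))))
      (ψ := fun x => g (n + 1) (x (a + (n + 1) * (M + 1))))
      (Finset.measurable_prod _ fun k _ => (hg k).comp (measurable_pi_apply _))
      ((hg _).comp (measurable_pi_apply _)) ?_ ?_
    · intro x y hxy
      refine Finset.prod_congr rfl fun k hk => ?_
      rw [hxy]
      have : k * (M + 1) ≤ n * (M + 1) :=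
        Nat.mul_le_mul_right _ (by have := Finset.mem_range.1 hk; omega)
      simpa using this
    · intro x y hxy
      simp only
      rw [hxy]
      simp only [Set.mem_Ici]
      linarith [add_mul n 1 (M + 1)]

/-! ### Negative moments of sums of squares -/

/-- The negative square root near the origin, cut off outside `[-1, 1]`. -/
noncomputable def truncInvSqrt (x : ℝ) : ENNReal :=
  (Set.Icc (-1) 1).indicator (fun y : ℝ => ENNReal.ofReal (|y| ^ (-1 / 2 : ℝ))) x

/-- A bound for `𝔼 |Z - v| ^ (-1/2)`, for every real `v` and every `Z` with density at most `c`. -/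
noncomputable def invSqrtBound (c : ℝ) : ℝ :=
  (1 + ENNReal.ofReal c * ∫⁻ x, truncInvSqrt x).toReal

lemma measurable_truncInvSqrt : Measurable truncInvSqrt := by
  refine Measurable.indicator ?_ measurableSet_Icc
  fun_prop

lemma lintegral_truncInvSqrt_ne_top : ∫⁻ x, truncInvSqrt x ≠ ⊤ := by
  have h1 : IntervalIntegrable (fun x : ℝ => |x| ^ (-1 / 2 : ℝ)) volume 0 1 := by
    refine (intervalIntegral.intervalIntegrable_rpow' (r := (-1 / 2 : ℝ)) (by norm_num)).congr ?_
    intro x hx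
    rw [Set.uIoc_of_le zero_le_one] at hx
    simp only [abs_of_pos hx.1]
  have h2 : IntervalIntegrable (fun x : ℝ => |x| ^ (-1 / 2 : ℝ)) volume (-1) 0 := by
    have := (h1.comp_mul_left (c := -1)).symm
    simpa using this
  have h3 := (intervalIntegrable_iff_integrableOn_Icc_of_le (by norm_num)).1 (h2.trans h1)
  have h4 := h3.lintegral_lt_top
  unfold truncInvSqrt
  rw [lintegral_indicator measurableSet_Icc]
  exact h4.ne

lemma ofReal_invSqrtBound (c : ℝ) :
    ENNReal.ofReal (invSqrtBound c) = 1 + ENNReal.ofReal c * ∫⁻ x, truncInvSqrt x :=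
  ENNReal.ofReal_toReal (by simp [ENNReal.mul_eq_top, lintegral_truncInvSqrt_ne_top])

lemma invSqrtBound_nonneg (c : ℝ) : 0 ≤ invSqrtBound c := ENNReal.toReal_nonneg

section

variable {Ω : Type*} [MeasurableSpace Ω] {P : Measure Ω} {M : ℕ} {q c σmin C : ℝ}
  {X : ℕ → Ω → ℝ}

lemma InClassD.lintegral_comp_le (h : InClassD P M q c σmin C X) (i : ℕ) {g : ℝ → ENNReal}
    (hg : Measurable g) : ∫⁻ ω, g (X i ω) ∂P ≤ ENNReal.ofReal c * ∫⁻ x, g x := by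
  have := h.hasPDF i
  rw [← lintegral_map hg (h.measurable i), map_eq_withDensity_pdf (X i) P volume,
    lintegral_withDensity_eq_lintegral_mul _ (measurable_pdf _ _ _) hg, ← lintegral_const_mul _ hg]
  refine lintegral_mono_ae ?_
  filter_upwards [h.pdf_le i] with x hx
  exact mul_le_mul_left hx _

lemma InClassD.ae_ne (h : InClassD P M q c σmin C X) (i : ℕ) (v : ℝ) : ∀ᵐ ω ∂P, X i ω ≠ v := by
  have := h.hasPDF i
  have h0 : P.map (X i) ≪ volume := HasPDF.absolutelyContinuous
  have h1 : ∀ᵐ x ∂(P.map (X i)), x ≠ v := h0.ae_le (Measure.ae_ne volume v)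
  exact ae_of_ae_map (h.measurable i).aemeasurable h1

lemma InClassD.lintegral_inv_sqrt_le [IsProbabilityMeasure P] (h : InClassD P M q c σmin C X)
    (i : ℕ) (v : ℝ) :
    ∫⁻ ω, ENNReal.ofReal (|X i ω - v| ^ (-1 / 2 : ℝ)) ∂P ≤ ENNReal.ofReal (invSqrtBound c) := by
  have hm : Measurable fun x : ℝ => truncInvSqrt (x - v) :=
    measurable_truncInvSqrt.comp (measurable_id.sub_const v)
  calc ∫⁻ ω, ENNReal.ofReal (|X i ω - v| ^ (-1 / 2 : ℝ)) ∂P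
      ≤ ∫⁻ ω, (1 + truncInvSqrt (X i ω - v)) ∂P := by
        refine lintegral_mono fun ω => ?_
        by_cases hx : X i ω - v ∈ Set.Icc (-1 : ℝ) 1
        · rw [truncInvSqrt, Set.indicator_of_mem hx]
          exact le_add_self
        · refine le_trans ?_ le_self_add
          rw [ENNReal.ofReal_le_one]
          refine Real.rpow_le_one_of_one_le_of_nonpos ?_ (by norm_num)
          rw [Set.mem_Icc, ← abs_le] at hx
          exact (not_le.1 hx).le
    _ = 1 + ∫⁻ ω, truncInvSqrt (X i ω - v) ∂P := by
        rw [lintegral_add_left measurable_const]; simp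
    _ ≤ 1 + ENNReal.ofReal c * ∫⁻ x, truncInvSqrt (x - v) := by
        gcongr
        exact h.lintegral_comp_le i hm
    _ = _ := by
        rw [lintegral_sub_right_eq_self (fun x => truncInvSqrt x) v, ofReal_invSqrtBound]

/-- Jensen's inequality for the concave power `x ^ θ`. -/
lemma lintegral_rpow_le_rpow_lintegral [IsProbabilityMeasure P] {f : Ω → ENNReal}
    (hf : AEMeasurable f P) {θ : ℝ} (h0 : 0 < θ) (h1 : θ ≤ 1) :
    ∫⁻ ω, f ω ^ θ ∂P ≤ (∫⁻ ω, f ω ∂P) ^ θ := by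
  have := eLpNorm'_le_eLpNorm'_of_exponent_le (f := f) (μ := P) h0 h1 hf.aestronglyMeasurable
  simp only [eLpNorm', enorm_eq_self, ENNReal.rpow_one, one_div, inv_one] at this
  rwa [ENNReal.rpow_inv_le_iff h0] at this

end

/-- By the inequality of arithmetic and geometric means, a negative power of a sum of `n` squares
is at most a product of negative powers with an exponent of order `1 / n`. -/
lemma inv_sqrt_sum_sq_pow_three_le {n : ℕ} (hn : 0 < n) (z : ℕ → ℝ) (hz : ∀ k, z k ≠ 0) :
    (√(∑ k ∈ Finset.range n, z k ^ 2))⁻¹ ^ 3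
      ≤ (√n)⁻¹ ^ 3 * ∏ k ∈ Finset.range n, |z k| ^ (-3 / n : ℝ) := by
  have hn' : (0 : ℝ) < n := by exact_mod_cast hn
  have e (x : ℝ) (hx : 0 ≤ x) : (√x)⁻¹ ^ 3 = x ^ (-3 / 2 : ℝ) := by
    rw [Real.sqrt_eq_rpow, ← Real.rpow_neg hx, ← Real.rpow_natCast, ← Real.rpow_mul hx]
    norm_num
  have hpos (k : ℕ) : 0 < z k ^ 2 := by have := hz k; positivity
  have hT : 0 < ∑ k ∈ Finset.range n, z k ^ 2 :=
    Finset.sum_pos (fun k _ => hpos k) ⟨0, Finset.mem_range.2 hn⟩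
  have hgm := Real.geom_mean_le_arith_mean_weighted (Finset.range n) (fun _ => 1 / (n : ℝ))
    (fun k => z k ^ 2) (fun _ _ => by positivity) (by simp [hn'.ne']) (fun k _ => (hpos k).le)
  rw [← Finset.mul_sum] at hgm
  have hprod : 0 < ∏ k ∈ Finset.range n, (z k ^ 2) ^ (1 / (n : ℝ)) :=
    Finset.prod_pos fun k _ => Real.rpow_pos_of_pos (hpos k) _
  have h1 := Real.rpow_le_rpow_of_nonpos hprod hgm (z := -3 / 2) (by norm_num)
  rw [Real.mul_rpow (by positivity) hT.le, ← Real.finsetProd_rpow _ _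
    (fun k _ => Real.rpow_nonneg (hpos k).le _)] at h1
  have h2 : ∏ k ∈ Finset.range n, ((z k ^ 2) ^ (1 / (n : ℝ))) ^ (-3 / 2 : ℝ)
      = ∏ k ∈ Finset.range n, |z k| ^ (-3 / n : ℝ) := by
    refine Finset.prod_congr rfl fun k _ => ?_
    rw [← sq_abs, ← Real.rpow_natCast, ← Real.rpow_mul (abs_nonneg _),
      ← Real.rpow_mul (abs_nonneg _)]
    congr 1
    push_cast
    field_simp
  rw [h2] at h1
  rw [e _ hT.le, e _ hn'.le]
  have h3 : (1 / (n : ℝ)) ^ (-3 / 2 : ℝ) = ((n : ℝ) ^ (-3 / 2 : ℝ))⁻¹ := by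
    rw [one_div, Real.inv_rpow hn'.le]
  rw [h3, inv_mul_le_iff₀ (by positivity)] at h1
  exact h1

section

variable {Ω : Type*} [MeasurableSpace Ω] {P : Measure Ω} [IsProbabilityMeasure P] {M : ℕ}
  {q c σmin C : ℝ} {X : ℕ → Ω → ℝ}

/-- Each factor `|Z| ^ (-3/n)` of the product is the power `6 / n ≤ 1` of `|Z| ^ (-1/2)`, so its
expectation is at most `K ^ (6/n)`, and `n` such factors contribute `K ^ 6`. -/
lemma InClassD.lintegral_inv_sqrt_sum_sq_pow_three_le (h : InClassD P M q c σmin C X)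
    (a n : ℕ) (hn : 6 ≤ n) (v : ℕ → ℝ) :
    ∫⁻ ω, ENNReal.ofReal ((√(∑ k ∈ Finset.range n, (X (a + k * (M + 1)) ω - v k) ^ 2))⁻¹ ^ 3) ∂P
      ≤ ENNReal.ofReal ((√n)⁻¹ ^ 3 * invSqrtBound c ^ 6) := by
  have hn' : (6 : ℝ) ≤ n := by exact_mod_cast hn
  have hn0 : (0 : ℝ) < n := by linarith
  have hθ : (0 : ℝ) < 6 / n := by positivity
  have hm (k : ℕ) : Measurable fun x : ℝ => ENNReal.ofReal (|x - v k| ^ (-3 / n : ℝ)) := by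
    fun_prop
  have hfac (k : ℕ) : ∫⁻ ω, ENNReal.ofReal (|X (a + k * (M + 1)) ω - v k| ^ (-3 / n : ℝ)) ∂P
      ≤ ENNReal.ofReal (invSqrtBound c) ^ (6 / n : ℝ) := by
    calc ∫⁻ ω, ENNReal.ofReal (|X (a + k * (M + 1)) ω - v k| ^ (-3 / n : ℝ)) ∂P
        = ∫⁻ ω, ENNReal.ofReal (|X (a + k * (M + 1)) ω - v k| ^ (-1 / 2 : ℝ)) ^ (6 / n : ℝ) ∂P := by
          refine lintegral_congr fun ω => ?_
          rw [ENNReal.ofReal_rpow_of_nonneg (by positivity) hθ.le, ← Real.rpow_mul (abs_nonneg _)]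
          congr 2
          ring
      _ ≤ (∫⁻ ω, ENNReal.ofReal (|X (a + k * (M + 1)) ω - v k| ^ (-1 / 2 : ℝ)) ∂P) ^ (6 / n : ℝ) :=
          lintegral_rpow_le_rpow_lintegral
            (by have := h.measurable (a + k * (M + 1)); fun_prop) hθ
            (by rw [div_le_one hn0]; exact hn')
      _ ≤ _ := by
          gcongr
          exact h.lintegral_inv_sqrt_le _ _
  -- The real power of zero is a junk value, so the pointwise inequality holds only off zero.
  have hne : ∀ᵐ ω ∂P, ∀ k, X (a + k * (M + 1)) ω - v k ≠ 0 := by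
    rw [ae_all_iff]
    intro k
    filter_upwards [h.ae_ne (a + k * (M + 1)) (v k)] with ω hω
    exact sub_ne_zero.2 hω
  calc _ ≤ ∫⁻ ω, ENNReal.ofReal ((√n)⁻¹ ^ 3) * ∏ k ∈ Finset.range n,
          ENNReal.ofReal (|X (a + k * (M + 1)) ω - v k| ^ (-3 / n : ℝ)) ∂P := by
        refine lintegral_mono_ae ?_
        filter_upwards [hne] with ω hω
        rw [← ENNReal.ofReal_prod_of_nonneg (fun k _ => by positivity),
          ← ENNReal.ofReal_mul (by positivity)]
        exact ENNReal.ofReal_le_ofReal (inv_sqrt_sum_sq_pow_three_le (by omega) _ hω)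
    _ = ENNReal.ofReal ((√n)⁻¹ ^ 3) * ∏ k ∈ Finset.range n,
          ∫⁻ ω, ENNReal.ofReal (|X (a + k * (M + 1)) ω - v k| ^ (-3 / n : ℝ)) ∂P := by
        have hX := h.measurable
        rw [lintegral_const_mul _ (by fun_prop), h.mDependent.lintegral_prod_spaced h.measurable _ hm]
    _ ≤ ENNReal.ofReal ((√n)⁻¹ ^ 3) * ∏ k ∈ Finset.range n,
          ENNReal.ofReal (invSqrtBound c) ^ (6 / n : ℝ) := by
        gcongr with k _
        exact hfac k
    _ = ENNReal.ofReal ((√n)⁻¹ ^ 3 * invSqrtBound c ^ 6) := by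
        rw [ENNReal.ofReal_mul (by positivity), ENNReal.ofReal_pow (invSqrtBound_nonneg c),
          Finset.prod_const, Finset.card_range, ← ENNReal.rpow_natCast, ← ENNReal.rpow_mul,
          div_mul_cancel₀ _ hn0.ne', ← ENNReal.rpow_natCast]
        norm_num

/-- The third negative moment of the norm of `n` spaced coordinates is of order `n ^ (-3/2)`,
uniformly in the centre `v`. The bound on the densities alone is responsible for this. -/
lemma InClassD.integral_inv_sqrt_sum_sq_pow_three_le (h : InClassD P M q c σmin C X)
    (a n : ℕ) (hn : 6 ≤ n) (v : ℕ → ℝ) :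
    Integrable (fun ω =>
      (√(∑ k ∈ Finset.range n, (X (a + k * (M + 1)) ω - v k) ^ 2))⁻¹ ^ 3) P ∧
    ∫ ω, (√(∑ k ∈ Finset.range n, (X (a + k * (M + 1)) ω - v k) ^ 2))⁻¹ ^ 3 ∂P
      ≤ (√n)⁻¹ ^ 3 * invSqrtBound c ^ 6 := by
  have key := h.lintegral_inv_sqrt_sum_sq_pow_three_le a n hn v
  have hX := h.measurable
  have hmeas : Measurable fun ω =>
      (√(∑ k ∈ Finset.range n, (X (a + k * (M + 1)) ω - v k) ^ 2))⁻¹ ^ 3 := by fun_prop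
  have hnn : 0 ≤ᵐ[P] fun ω =>
      (√(∑ k ∈ Finset.range n, (X (a + k * (M + 1)) ω - v k) ^ 2))⁻¹ ^ 3 :=
    Filter.Eventually.of_forall fun ω => by positivity
  have hb := invSqrtBound_nonneg c
  refine ⟨(lintegral_ofReal_ne_top_iff_integrable hmeas.aestronglyMeasurable hnn).1
    (key.trans_lt ENNReal.ofReal_lt_top).ne, ?_⟩
  rw [integral_eq_lintegral_of_nonneg_ae hnn hmeas.aestronglyMeasurable]
  exact ENNReal.toReal_le_of_le_ofReal (by positivity) key

end

/-! ### Geometric medians -/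

section

variable {Ω : Type*} [MeasurableSpace Ω] {P : Measure Ω} {p : ℕ}
  {Y : Ω → EuclideanSpace ℝ (Fin p)}

lemma exists_isGeometricMedian [IsProbabilityMeasure P] (hY : Integrable Y P) :
    ∃ m, IsGeometricMedian P Y m := by
  have hint (v : EuclideanSpace ℝ (Fin p)) : Integrable (fun ω => ‖Y ω - v‖) P :=
    (hY.sub (integrable_const v)).norm
  have hlip : LipschitzWith 1 (fun v => ∫ ω, ‖Y ω - v‖ ∂P) := by
    refine LipschitzWith.of_le_add fun v w => ?_
    have : ∫ ω, (‖Y ω - w‖ + dist v w) ∂P = ∫ ω, ‖Y ω - w‖ ∂P + dist v w := by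
      rw [integral_add (hint w) (integrable_const _)]; simp
    rw [← this]
    refine integral_mono (hint v) ((hint w).add (integrable_const _)) fun ω => ?_
    simp only [← dist_eq_norm]
    rw [dist_comm v w]
    exact dist_triangle _ _ _
  -- Coercivity: the expected distance to `v` is at least `‖v‖ - 𝔼 ‖Y‖`.
  obtain ⟨m, hm⟩ := hlip.continuous.exists_forall_le (by
    refine Filter.tendsto_atTop_mono (f := fun v => ‖v‖ + -∫ ω, ‖Y ω‖ ∂P) (fun v => ?_)
      (Filter.tendsto_atTop_add_const_right _ _ tendsto_norm_cocompact_atTop)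
    have : ∫ ω, (‖v‖ - ‖Y ω‖) ∂P = ‖v‖ + -∫ ω, ‖Y ω‖ ∂P := by
      rw [integral_sub (integrable_const _) hY.norm]; simp [sub_eq_add_neg]
    rw [← this]
    refine integral_mono ((integrable_const _).sub hY.norm) (hint v) fun ω => ?_
    rw [norm_sub_rev]
    exact norm_sub_norm_le _ _)
  exact ⟨m, hm⟩

/-- A geometric median is unique when the law charges no line: the triangle inequality at the
midpoint of two distinct medians is strict off the line through them. -/
lemma IsGeometricMedian.eq_of_ae_not_sameRay [IsProbabilityMeasure P] (hY : Integrable Y P)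
    {m₁ m₂ : EuclideanSpace ℝ (Fin p)} (h₁ : IsGeometricMedian P Y m₁)
    (h₂ : IsGeometricMedian P Y m₂)
    (hline : m₁ ≠ m₂ → ∀ᵐ ω ∂P, ¬ SameRay ℝ (Y ω - m₁) (Y ω - m₂)) : m₁ = m₂ := by
  by_contra hne
  have hint (v : EuclideanSpace ℝ (Fin p)) : Integrable (fun ω => ‖Y ω - v‖) P :=
    (hY.sub (integrable_const v)).norm
  set v := (1 / 2 : ℝ) • (m₁ + m₂) with hv
  have hlt : ∀ᵐ ω ∂P, 0 < ‖Y ω - m₁‖ + ‖Y ω - m₂‖ - 2 * ‖Y ω - v‖ := by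
    filter_upwards [hline hne] with ω hω
    have h := norm_add_lt_of_not_sameRay hω
    have e : (Y ω - m₁) + (Y ω - m₂) = (2 : ℝ) • (Y ω - v) := by rw [hv]; module
    rw [e, norm_smul] at h
    norm_num at h
    linarith
  have hadd : Integrable (fun ω => ‖Y ω - m₁‖ + ‖Y ω - m₂‖) P := (hint m₁).add (hint m₂)
  have hi := hadd.sub ((hint v).const_mul 2)
  have hpos : 0 < ∫ ω, (‖Y ω - m₁‖ + ‖Y ω - m₂‖ - 2 * ‖Y ω - v‖) ∂P := by
    refine (integral_pos_iff_support_of_nonneg_ae ?_ hi).2 ?_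
    · filter_upwards [hlt] with ω hω using hω.le
    · refine (pos_iff_ne_zero.2 fun h0 => ?_)
      have : ∀ᵐ ω ∂P, False := by
        filter_upwards [hlt, measure_eq_zero_iff_ae_notMem.1 h0] with ω hω hω'
        exact hω' hω.ne'
      simp [ae_iff] at this
  rw [integral_sub hadd ((hint v).const_mul 2),
    integral_add (hint m₁) (hint m₂), integral_const_mul] at hpos
  have := h₁ v
  have := h₂ v
  linarith

/-- The first-order condition satisfied by a geometric median that is not an atom. -/
lemma IsGeometricMedian.integral_div_norm_eq_zero [IsProbabilityMeasure P] (hY : Integrable Y P)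
    {m : EuclideanSpace ℝ (Fin p)} (hm : IsGeometricMedian P Y m) (hne : ∀ᵐ ω ∂P, Y ω ≠ m)
    (i : Fin p) :
    Integrable (fun ω => (Y ω i - m i) / ‖Y ω - m‖) P ∧
      ∫ ω, (Y ω i - m i) / ‖Y ω - m‖ ∂P = 0 := by
  set e : EuclideanSpace ℝ (Fin p) := EuclideanSpace.single i 1 with he
  have hen : ‖e‖ = 1 := by simp [he]
  have hint (v : EuclideanSpace ℝ (Fin p)) : Integrable (fun ω => ‖Y ω - v‖) P :=
    (hY.sub (integrable_const v)).norm
  have hYi : Integrable (fun ω => Y ω i) P := integrable_piLp_iff.1 hY i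
  have key := hasDerivAt_integral_of_dominated_loc_of_lip (μ := P) (𝕜 := ℝ)
    (F := fun t ω => ‖Y ω - (m + t • e)‖) (F' := fun ω => -((Y ω i - m i) / ‖Y ω - m‖))
    (x₀ := 0) (s := Set.univ) (bound := fun _ => 1) Filter.univ_mem
    (Filter.Eventually.of_forall fun t => (hint _).aestronglyMeasurable)
    (hint _) ?_ ?_ (integrable_const _) ?_
  · obtain ⟨k1, k2⟩ := key
    have hmin : IsLocalMin (fun t : ℝ => ∫ ω, ‖Y ω - (m + t • e)‖ ∂P) 0 :=
      Filter.Eventually.of_forall fun t => by simpa using hm (m + t • e)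
    have h0 := hmin.hasDerivAt_eq_zero k2
    rw [integral_neg, neg_eq_zero] at h0
    exact ⟨by simpa using k1.neg, h0⟩
  · exact ((hYi.sub (integrable_const _)).aestronglyMeasurable.aemeasurable.div
      (hint m).aestronglyMeasurable.aemeasurable).neg.aestronglyMeasurable
  · refine Filter.Eventually.of_forall fun ω => ?_
    refine LipschitzOnWith.of_dist_le_mul fun s _ t _ => ?_
    rw [Real.dist_eq, dist_comm, dist_eq_norm]
    refine (abs_norm_sub_norm_le _ _).trans ?_
    have : Y ω - (m + s • e) - (Y ω - (m + t • e)) = (t - s) • e := by module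
    rw [this, norm_smul, hen]
    simp
  · filter_upwards [hne] with ω hω
    have hpos : 0 < ‖Y ω - m‖ := norm_pos_iff.2 (sub_ne_zero.2 hω)
    have hform (t : ℝ) : ‖Y ω - (m + t • e)‖
        = √(‖Y ω - m‖ ^ 2 - 2 * t * (Y ω i - m i) + t ^ 2) := by
      rw [← Real.sqrt_sq (norm_nonneg (Y ω - (m + t • e)))]
      congr 1
      have : Y ω - (m + t • e) = (Y ω - m) - t • e := by module
      rw [this, norm_sub_sq_real, norm_smul, hen, inner_smul_right, he,
        EuclideanSpace.inner_single_right]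
      simp
      ring
    simp_rw [hform]
    have hd : HasDerivAt (fun t : ℝ => ‖Y ω - m‖ ^ 2 - 2 * t * (Y ω i - m i) + t ^ 2)
        (-(2 * (Y ω i - m i))) 0 := by
      refine HasDerivAt.congr_deriv (((((hasDerivAt_id' (0 : ℝ)).const_mul 2).mul_const
        (Y ω i - m i)).const_sub (‖Y ω - m‖ ^ 2)).add (hasDerivAt_pow 2 0)) ?_
      simp
    refine (hd.sqrt (by simp [hpos.ne'])).congr_deriv ?_
    simp only [mul_zero, zero_mul, sub_zero, ne_eq, OfNat.ofNat_ne_zero, not_false_eq_true,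
      zero_pow, add_zero, Real.sqrt_sq hpos.le]
    field_simp

end

/-! ### Moments -/

section

variable {Ω : Type*} [MeasurableSpace Ω] {P : Measure Ω} [IsProbabilityMeasure P] {M : ℕ}
  {q c σmin C : ℝ} {X : ℕ → Ω → ℝ}

lemma pow_le_one_add_rpow {t q : ℝ} (ht : 0 ≤ t) {j : ℕ} (hj : (j : ℝ) ≤ q) :
    t ^ j ≤ 1 + t ^ q := by
  have h0 : 0 ≤ t ^ q := Real.rpow_nonneg ht q
  rcases le_total t 1 with h | h
  · linarith [pow_le_one₀ (n := j) ht h]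
  · have := Real.rpow_le_rpow_of_exponent_le h hj
    rw [Real.rpow_natCast] at this
    linarith

lemma InClassD.integrable (h : InClassD P M q c σmin C X) (hq : 3 ≤ q) (i : ℕ) :
    Integrable (X i) P := by
  refine Integrable.mono' ((integrable_const 1).add (h.integrable_moment i))
    (h.measurable i).aestronglyMeasurable (Filter.Eventually.of_forall fun ω => ?_)
  have := pow_le_one_add_rpow (abs_nonneg (X i ω)) (j := 1) (q := q) (by norm_num; linarith)
  simpa using this

lemma InClassD.centered_pow (h : InClassD P M q c σmin C X) (hq : 3 ≤ q) (i : ℕ) {j : ℕ}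
    (hj : j ≤ 3) :
    Integrable (fun ω => |X i ω - ∫ ω', X i ω' ∂P| ^ j) P ∧
      ∫ ω, |X i ω - ∫ ω', X i ω' ∂P| ^ j ∂P ≤ 1 + C := by
  have hX := h.measurable i
  have hj' : (j : ℝ) ≤ q := le_trans (by exact_mod_cast hj) hq
  have hb := (integrable_const (1 : ℝ)).add (h.integrable_centered_moment i)
  have hi : Integrable (fun ω => |X i ω - ∫ ω', X i ω' ∂P| ^ j) P := by
    refine Integrable.mono' hb (by fun_prop) (Filter.Eventually.of_forall fun ω => ?_)
    rw [Real.norm_of_nonneg (by positivity)]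
    exact pow_le_one_add_rpow (abs_nonneg _) hj'
  refine ⟨hi, (integral_mono hi hb fun ω => pow_le_one_add_rpow (abs_nonneg _) hj').trans ?_⟩
  simp only [Pi.add_apply]
  rw [integral_add (integrable_const _) (h.integrable_centered_moment i)]
  have := h.centered_moment_le i
  simp
  linarith

lemma InClassD.integrable_firstTerms (h : InClassD P M q c σmin C X) (hq : 3 ≤ q) (p : ℕ) :
    Integrable (firstTerms X p) P :=
  integrable_piLp_iff.2 fun i => h.integrable hq i

lemma InClassD.integral_norm_sub_meanVector_le (h : InClassD P M q c σmin C X) (hq : 3 ≤ q)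
    (hC : 1 ≤ C) {p : ℕ} (hp : 1 ≤ p) :
    ∫ ω, ‖firstTerms X p ω - meanVector P X p‖ ∂P ≤ (1 + C) * √p := by
  have hp' : (0 : ℝ) < √p := Real.sqrt_pos.2 (by exact_mod_cast hp)
  have hsq : √(p : ℝ) ^ 2 = p := Real.sq_sqrt (Nat.cast_nonneg p)
  have hi := ((h.integrable_firstTerms hq p).sub (integrable_const (meanVector P X p))).norm
  have hs (ω : Ω) : ‖firstTerms X p ω - meanVector P X p‖ ^ 2
      = ∑ i : Fin p, |X i ω - ∫ ω', X i ω' ∂P| ^ 2 := by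
    rw [EuclideanSpace.norm_sq_eq]
    rfl
  have hi2 : Integrable (fun ω => ∑ i : Fin p, |X i ω - ∫ ω', X i ω' ∂P| ^ 2) P :=
    integrable_finsetSum _ fun i _ => (h.centered_pow hq i (by norm_num)).1
  -- Young's inequality `2 x ≤ x ^ 2 / √p + √p` replaces the Cauchy-Schwarz inequality.
  have h1 : ∫ ω, ‖firstTerms X p ω - meanVector P X p‖ ∂P
      ≤ ∫ ω, ((2 * √p)⁻¹ * (∑ i : Fin p, |X i ω - ∫ ω', X i ω' ∂P| ^ 2) + √p / 2) ∂P := by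
    refine integral_mono hi ((hi2.const_mul _).add (integrable_const _)) fun ω => ?_
    simp only [← hs]
    set x := ‖firstTerms X p ω - meanVector P X p‖
    have : (2 * √(p : ℝ))⁻¹ * x ^ 2 + √p / 2 - x = (2 * √(p : ℝ))⁻¹ * (x - √p) ^ 2 := by
      field_simp
      ring
    have : 0 ≤ (2 * √(p : ℝ))⁻¹ * (x - √p) ^ 2 := by positivity
    linarith
  have h2 : ∫ ω, (∑ i : Fin p, |X i ω - ∫ ω', X i ω' ∂P| ^ 2) ∂P ≤ p * (1 + C) := by
    rw [integral_finsetSum _ fun (i : Fin p) _ => (h.centered_pow hq i (by norm_num)).1]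
    refine (Finset.sum_le_sum fun (i : Fin p) _ =>
      (h.centered_pow hq i (j := 2) (by norm_num)).2).trans ?_
    simp [mul_add]
  rw [integral_add (hi2.const_mul _) (integrable_const _), integral_const_mul] at h1
  simp only [integral_const, probReal_univ, one_smul] at h1
  have h3 : (2 * √(p : ℝ))⁻¹ * ∫ ω, (∑ i : Fin p, |X i ω - ∫ ω', X i ω' ∂P| ^ 2) ∂P
      ≤ (2 * √(p : ℝ))⁻¹ * (p * (1 + C)) := by gcongr
  have h4 : (2 * √(p : ℝ))⁻¹ * (p * (1 + C)) = √p * (1 + C) / 2 := by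
    nth_rw 2 [← hsq]
    field_simp
  nlinarith

/-- The coordinates `X 0` and `X (M + 1)` are independent and have densities, so the random vector
of the first `p ≥ M + 2` terms almost surely avoids any given line. -/
lemma InClassD.ae_not_sameRay (h : InClassD P M q c σmin C X) {p : ℕ} (hp : M + 2 ≤ p)
    {m₁ m₂ : EuclideanSpace ℝ (Fin p)} (hne : m₁ ≠ m₂) :
    ∀ᵐ ω ∂P, ¬ SameRay ℝ (firstTerms X p ω - m₁) (firstTerms X p ω - m₂) := by
  let i0 : Fin p := ⟨0, by omega⟩
  let i1 : Fin p := ⟨M + 1, by omega⟩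
  have hind : IndepFun (X 0) (X (M + 1)) P :=
    h.mDependent.indepFun_of_dependsOn 0 (φ := fun x => x 0) (ψ := fun x => x (M + 1))
      (measurable_pi_apply _) (measurable_pi_apply _)
      (fun x y hxy => hxy 0 (by simp)) (fun x y hxy => hxy (M + 1) (by simp))
  have hgraph (α β : ℝ) : ∀ᵐ ω ∂P, X (M + 1) ω ≠ α + β * X 0 ω := by
    have hm : MeasurableSet {z : ℝ × ℝ | z.2 ≠ α + β * z.1} :=
      (measurableSet_eq_fun measurable_snd (by fun_prop)).compl
    have h1 : ∀ᵐ z ∂(P.map fun ω => (X 0 ω, X (M + 1) ω)), z.2 ≠ α + β * z.1 := by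
      rw [(indepFun_iff_map_prod_eq_prod_map_map (h.measurable _).aemeasurable
        (h.measurable _).aemeasurable).1 hind, Measure.ae_prod_iff_ae_ae hm]
      refine Filter.Eventually.of_forall fun x => ?_
      exact (ae_map_iff (h.measurable _).aemeasurable (p := fun y => y ≠ α + β * x)
        (measurableSet_singleton _).compl).2 (h.ae_ne _ _)
    exact ae_of_ae_map ((h.measurable _).prodMk (h.measurable _)).aemeasurable h1
  -- A point on the line through `m₁` and `m₂` is `m₁ + t • (m₂ - m₁)`.
  have hline (x : EuclideanSpace ℝ (Fin p)) (hx : SameRay ℝ (x - m₁) (x - m₂)) :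
      ∃ t : ℝ, ∀ j, x j = m₁ j + t * (m₂ j - m₁ j) := by
    obtain ⟨a, b, -, -, hab, ha, hb⟩ := hx.exists_eq_smul_add
    have hsmul : b • (x - m₁) = a • (x - m₂) :=
      (congrArg (b • ·) ha).trans ((smul_comm _ _ _).trans (congrArg (a • ·) hb.symm))
    have hj (j : Fin p) : b * (x j - m₁ j) = a * (x j - m₂ j) := by
      have := congrArg (fun v : EuclideanSpace ℝ (Fin p) => v j) hsmul
      simpa using this
    have hab' : a - b ≠ 0 := by
      intro h0
      have h1 : b = 1 / 2 := by linarith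
      have h2 : a = 1 / 2 := by linarith
      refine hne ?_
      ext j
      have := hj j
      rw [h1, h2] at this
      linarith
    refine ⟨a / (a - b), fun j => ?_⟩
    have := hj j
    field_simp
    linear_combination -this
  by_cases hd : m₂ i0 - m₁ i0 = 0
  · filter_upwards [h.ae_ne 0 (m₁ i0)] with ω hω hs
    obtain ⟨t, ht⟩ := hline _ hs
    have := ht i0
    rw [hd, mul_zero, add_zero] at this
    exact hω this
  · filter_upwards [hgraph (m₁ i1 - (m₂ i1 - m₁ i1) / (m₂ i0 - m₁ i0) * m₁ i0)
      ((m₂ i1 - m₁ i1) / (m₂ i0 - m₁ i0))] with ω hω hs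
    obtain ⟨t, ht⟩ := hline _ hs
    have e0 : X 0 ω = m₁ i0 + t * (m₂ i0 - m₁ i0) := ht i0
    have e1 : X (M + 1) ω = m₁ i1 + t * (m₂ i1 - m₁ i1) := ht i1
    refine hω ?_
    rw [e0, e1]
    field_simp
    ring

end

/-! ### A dominating inverse distance -/

/-- The Euclidean distance from `X` to `v` in the coordinates `s`. -/
noncomputable def coordDist {Ω : Type*} (X : ℕ → Ω → ℝ) (v : ℕ → ℝ) (s : Finset ℕ) (ω : Ω) : ℝ :=
  √(∑ j ∈ s, (X j ω - v j) ^ 2)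

/-- The indices below `p` at distance more than `M` from `i`. -/
def farIndices (M p i : ℕ) : Finset ℕ := (Finset.range p).filter fun j => j + M < i ∨ i + M < j

/-- The indices below `p` at distance at most `M` from `i`. -/
def nearIndices (M p i : ℕ) : Finset ℕ :=
  (Finset.range p).filter fun j => ¬ (j + M < i ∨ i + M < j)

/-- A bound for `p ^ (3/2) * 𝔼 W ^ 3`, for the dominating inverse distance `W` of
`InClassD.exists_dominating_inv_dist`. -/
noncomputable def invDistBound (M : ℕ) (c : ℝ) : ℝ := √(8 * (M + 1)) ^ 3 * invSqrtBound c ^ 6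

lemma invDistBound_nonneg (M : ℕ) (c : ℝ) : 0 ≤ invDistBound M c := by
  have := invSqrtBound_nonneg c
  unfold invDistBound
  positivity

lemma coordDist_nonneg {Ω : Type*} (X : ℕ → Ω → ℝ) (v : ℕ → ℝ) (s : Finset ℕ) (ω : Ω) :
    0 ≤ coordDist X v s ω := Real.sqrt_nonneg _

lemma coordDist_sq {Ω : Type*} (X : ℕ → Ω → ℝ) (v : ℕ → ℝ) (s : Finset ℕ) (ω : Ω) :
    coordDist X v s ω ^ 2 = ∑ j ∈ s, (X j ω - v j) ^ 2 :=
  Real.sq_sqrt (Finset.sum_nonneg fun _ _ => sq_nonneg _)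

lemma coordDist_mono {Ω : Type*} (X : ℕ → Ω → ℝ) (v : ℕ → ℝ) {s t : Finset ℕ} (hst : s ⊆ t)
    (ω : Ω) : coordDist X v s ω ≤ coordDist X v t ω :=
  Real.sqrt_le_sqrt (Finset.sum_le_sum_of_subset_of_nonneg hst fun _ _ _ => sq_nonneg _)

lemma measurable_coordDist {Ω : Type*} [MeasurableSpace Ω] {X : ℕ → Ω → ℝ}
    (hX : ∀ i, Measurable (X i)) (v : ℕ → ℝ) (s : Finset ℕ) : Measurable (coordDist X v s) := by
  unfold coordDist
  fun_prop

/-- On one side of `i`, at distance more than `2 M`, there is an arithmetic progression of step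
`M + 1` whose length is proportional to `p`. -/
lemma exists_spaced_indices {M p i : ℕ} (hp : 24 * (M + 1) ≤ p) (hi : i < p) :
    ∃ a n : ℕ, 6 ≤ n ∧ p ≤ 8 * (M + 1) * n ∧ (∀ k < n, a + k * (M + 1) < p) ∧
      (i + 2 * M + 1 ≤ a ∨ ∀ k < n, a + k * (M + 1) + 2 * M + 1 ≤ i) := by
  set n := p / (4 * (M + 1)) with hn
  have h6 : 6 ≤ n := (Nat.le_div_iff_mul_le (by omega)).2 (by omega)
  have h1 : n * (4 * (M + 1)) ≤ p := Nat.div_mul_le_self _ _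
  have h2 : p < (n + 1) * (4 * (M + 1)) := by
    rw [mul_comm]; exact Nat.lt_mul_div_succ p (by omega)
  have hx1 : n * (4 * (M + 1)) = 4 * (n * (M + 1)) := by ring
  have hx2 : (n + 1) * (4 * (M + 1)) = 4 * (n * (M + 1)) + 4 * (M + 1) := by ring
  have hx3 : 8 * (M + 1) * n = 8 * (n * (M + 1)) := by ring
  have hx4 : 6 * (M + 1) ≤ n * (M + 1) := Nat.mul_le_mul_right _ h6
  have hk (k : ℕ) (h : k < n) : k * (M + 1) + (M + 1) ≤ n * (M + 1) := by
    calc k * (M + 1) + (M + 1) = (k + 1) * (M + 1) := by ring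
      _ ≤ _ := Nat.mul_le_mul_right _ h
  rcases lt_or_ge (2 * i) p with hip | hip
  · refine ⟨i + 2 * M + 1, n, h6, by omega, fun k h => ?_, Or.inl le_rfl⟩
    have := hk k h
    omega
  · refine ⟨0, n, h6, by omega, fun k h => ?_, Or.inr fun k h => ?_⟩ <;>
    · have := hk k h
      omega

section

variable {Ω : Type*} [MeasurableSpace Ω] {P : Measure Ω} [IsProbabilityMeasure P] {M : ℕ}
  {q c σmin C : ℝ} {X : ℕ → Ω → ℝ}

/-- A random variable `W` dominates the inverse distance in the coordinates far from `i`, has a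
third moment of order `p ^ (-3/2)`, and is independent of the coordinates near `i`. It is the
inverse distance along spaced coordinates on one side of `i` only, so that `M`-dependence applies
directly. -/
lemma InClassD.exists_dominating_inv_dist (h : InClassD P M q c σmin C X) {p i : ℕ}
    (hp : 24 * (M + 1) ≤ p) (hi : i < p) (v : ℕ → ℝ) :
    ∃ W : Ω → ℝ, Measurable W ∧ (∀ ω, 0 ≤ W ω) ∧ Integrable (fun ω => W ω ^ 3) P ∧
      ∫ ω, W ω ^ 3 ∂P ≤ invDistBound M c / √p ^ 3 ∧
      (∀ᵐ ω ∂P, 0 < coordDist X v (farIndices M p i) ω ∧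
        (coordDist X v (farIndices M p i) ω)⁻¹ ≤ W ω) ∧
      ∀ φ : (ℕ → ℝ) → ℝ, Measurable φ → DependsOn φ {j | i ≤ j + M ∧ j ≤ i + M} →
        IndepFun (fun ω => φ (fun j => X j ω)) W P := by
  obtain ⟨a, n, hn, hpn, hlt, hside⟩ := exists_spaced_indices hp hi
  have hX := h.measurable
  let ψ (x : ℕ → ℝ) : ℝ :=
    (√(∑ k ∈ Finset.range n, (x (a + k * (M + 1)) - v (a + k * (M + 1))) ^ 2))⁻¹
  have hψ : Measurable ψ := by fun_prop
  have hdep (s : Set ℕ) (hs : ∀ k < n, a + k * (M + 1) ∈ s) : DependsOn ψ s := by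
    intro x y hxy
    simp only [ψ]
    congr 2
    refine Finset.sum_congr rfl fun k hk => ?_
    rw [hxy _ (hs k (Finset.mem_range.1 hk))]
  have hmom := h.integral_inv_sqrt_sum_sq_pow_three_le a n hn (fun k => v (a + k * (M + 1)))
  have hb := invSqrtBound_nonneg c
  have hn0 : 0 < √(n : ℝ) := Real.sqrt_pos.2 (by exact_mod_cast (by omega : 0 < n))
  have hp0 : 0 < √(p : ℝ) := Real.sqrt_pos.2 (by exact_mod_cast (by omega : 0 < p))
  refine ⟨fun ω => (√(∑ k ∈ Finset.range n,
      (X (a + k * (M + 1)) ω - v (a + k * (M + 1))) ^ 2))⁻¹, by fun_prop,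
    fun ω => by positivity, hmom.1, hmom.2.trans ?_, ?_, ?_⟩
  · have h1 : √(p : ℝ) ≤ √(8 * (M + 1)) * √n := by
      rw [← Real.sqrt_mul (by positivity)]
      exact Real.sqrt_le_sqrt (by exact_mod_cast hpn)
    have h2 : (√(n : ℝ))⁻¹ ≤ √(8 * (M + 1)) / √p := by
      rw [inv_eq_one_div, div_le_div_iff₀ hn0 hp0]
      linarith
    calc (√(n : ℝ))⁻¹ ^ 3 * invSqrtBound c ^ 6
        ≤ (√(8 * (M + 1)) / √p) ^ 3 * invSqrtBound c ^ 6 := by gcongr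
      _ = _ := by rw [invDistBound]; ring
  · filter_upwards [h.ae_ne a (v a)] with ω hω
    have hsub : (Finset.range n).image (fun k => a + k * (M + 1)) ⊆ farIndices M p i := by
      intro j hj
      obtain ⟨k, hk, rfl⟩ := Finset.mem_image.1 hj
      have hk := Finset.mem_range.1 hk
      refine Finset.mem_filter.2 ⟨Finset.mem_range.2 (hlt k hk), ?_⟩
      rcases hside with hs | hs
      · have : 0 ≤ k * (M + 1) := Nat.zero_le _
        omega
      · have := hs k hk
        omega
    have hT : √(∑ k ∈ Finset.range n, (X (a + k * (M + 1)) ω - v (a + k * (M + 1))) ^ 2)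
        = coordDist X v ((Finset.range n).image fun k => a + k * (M + 1)) ω := by
      rw [coordDist, Finset.sum_image]
      intro k _ l _ hkl
      exact Nat.eq_of_mul_eq_mul_right (Nat.succ_pos M) (Nat.add_left_cancel hkl)
    have hTpos : 0 < √(∑ k ∈ Finset.range n,
        (X (a + k * (M + 1)) ω - v (a + k * (M + 1))) ^ 2) := by
      refine Real.sqrt_pos.2 (Finset.sum_pos' (fun _ _ => sq_nonneg _)
        ⟨0, Finset.mem_range.2 (by omega), ?_⟩)
      have : X a ω - v a ≠ 0 := sub_ne_zero.2 hω
      simpa using by positivity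
    have hle := coordDist_mono X v hsub ω
    rw [← hT] at hle
    exact ⟨hTpos.trans_le hle, inv_anti₀ hTpos hle⟩
  · intro φ hφ dφ
    rcases hside with hs | hs
    · refine h.mDependent.indepFun_of_dependsOn (i + M) hφ hψ (dφ.mono ?_) (hdep _ ?_)
      · intro j hj
        exact hj.2
      · intro k _
        have : 0 ≤ k * (M + 1) := Nat.zero_le _
        simp only [Set.mem_Ici]
        omega
    · have h0 := hs 0 (by omega)
      refine (h.mDependent.indepFun_of_dependsOn (i - (2 * M + 1)) hψ hφ (hdep _ ?_)
        (dφ.mono ?_)).symm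
      · intro k hk
        have := hs k hk
        simp only [Set.mem_Iic]
        omega
      · intro j hj
        have := hj.1
        simp only [Set.mem_Ici]
        omega

/-! ### Critical points of the expected distance -/

/-- The properties of a geometric median, with its coordinates read as the first `p` terms of a
sequence `v`, on which the estimate of its distance to the mean rests: the first-order condition
and a bound for the expected distance. -/
structure IsCriticalPoint (P : Measure Ω) (X : ℕ → Ω → ℝ) (p : ℕ) (V : ℝ) (v : ℕ → ℝ) : Prop where
  integrable_dist : Integrable (coordDist X v (Finset.range p)) P
  integral_dist_le : ∫ ω, coordDist X v (Finset.range p) ω ∂P ≤ V * √p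
  integrable_div : ∀ i < p, Integrable (fun ω => (X i ω - v i) / coordDist X v (Finset.range p) ω) P
  integral_div : ∀ i < p, ∫ ω, (X i ω - v i) / coordDist X v (Finset.range p) ω ∂P = 0

lemma farIndices_subset (M p i : ℕ) : farIndices M p i ⊆ Finset.range p := Finset.filter_subset _ _

lemma integrable_of_integrable_pow_three {W : Ω → ℝ} (hW : Measurable W) (h0 : ∀ ω, 0 ≤ W ω)
    (h3 : Integrable (fun ω => W ω ^ 3) P) : Integrable W P := by
  refine ((integrable_const (1 : ℝ)).add h3).mono' hW.aestronglyMeasurable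
    (Filter.Eventually.of_forall fun ω => ?_)
  rw [Real.norm_of_nonneg (h0 ω)]
  simp only [Pi.add_apply]
  nlinarith [h0 ω, sq_nonneg (W ω - 1), mul_nonneg (h0 ω) (sq_nonneg (W ω - 1))]

lemma InClassD.integrable_inv_coordDist (h : InClassD P M q c σmin C X) {p : ℕ}
    (hp : 24 * (M + 1) ≤ p) (v : ℕ → ℝ) :
    (∀ᵐ ω ∂P, 0 < coordDist X v (Finset.range p) ω) ∧
      Integrable (fun ω => (coordDist X v (Finset.range p) ω)⁻¹) P := by
  obtain ⟨W, hW, hW0, hW3, -, hdom, -⟩ :=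
    h.exists_dominating_inv_dist hp (i := 0) (by omega) v
  have hsub := farIndices_subset M p 0
  refine ⟨?_, (integrable_of_integrable_pow_three hW hW0 hW3).mono'
    (measurable_coordDist h.measurable v _).inv.aestronglyMeasurable ?_⟩
  · filter_upwards [hdom] with ω hω using hω.1.trans_le (coordDist_mono X v hsub ω)
  · filter_upwards [hdom] with ω hω
    rw [Real.norm_of_nonneg (inv_nonneg.2 (coordDist_nonneg _ _ _ _))]
    exact (inv_anti₀ hω.1 (coordDist_mono X v hsub ω)).trans hω.2

/-- Jensen's inequality for the inverse, from the tangent line of `x ↦ 1 / x` at `V √p`. -/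
lemma InClassD.le_integral_inv_coordDist (h : InClassD P M q c σmin C X) {p : ℕ}
    (hp : 24 * (M + 1) ≤ p) {V : ℝ} (hV : 0 < V) {v : ℕ → ℝ} (hv : IsCriticalPoint P X p V v) :
    1 / (V * √p) ≤ ∫ ω, (coordDist X v (Finset.range p) ω)⁻¹ ∂P := by
  obtain ⟨hpos, hint⟩ := h.integrable_inv_coordDist hp v
  have hp0 : 0 < √(p : ℝ) := Real.sqrt_pos.2 (by exact_mod_cast (by omega : 0 < p))
  set l := V * √p with hl
  have hl0 : 0 < l := by positivity
  have h1 : ∫ ω, (2 / l - coordDist X v (Finset.range p) ω / l ^ 2) ∂P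
      ≤ ∫ ω, (coordDist X v (Finset.range p) ω)⁻¹ ∂P := by
    refine integral_mono_ae ((integrable_const _).sub (hv.integrable_dist.div_const _)) hint ?_
    filter_upwards [hpos] with ω hω
    set r := coordDist X v (Finset.range p) ω
    have : r⁻¹ - (2 / l - r / l ^ 2) = (r - l) ^ 2 / (r * l ^ 2) := by field_simp; ring
    have : 0 ≤ (r - l) ^ 2 / (r * l ^ 2) := by positivity
    linarith
  rw [integral_sub (integrable_const _) (hv.integrable_dist.div_const _),
    integral_div (l ^ 2) (coordDist X v (Finset.range p))] at h1
  simp only [integral_const, probReal_univ, one_smul] at h1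
  have h2 : (∫ ω, coordDist X v (Finset.range p) ω ∂P) / l ^ 2 ≤ l / l ^ 2 := by
    gcongr
    exact hv.integral_dist_le
  have h3 : l / l ^ 2 = 1 / l := by field_simp
  have h4 : 2 / l = 1 / l + 1 / l := by ring
  linarith

/-- The first-order condition, solved for the deviation of `v i` from the mean. -/
lemma InClassD.sub_mul_integral_inv (h : InClassD P M q c σmin C X) {p : ℕ}
    (hp : 24 * (M + 1) ≤ p) {V : ℝ} {v : ℕ → ℝ} (hv : IsCriticalPoint P X p V v) {i : ℕ}
    (hi : i < p) :
    Integrable (fun ω => (X i ω - ∫ ω', X i ω' ∂P) * (coordDist X v (Finset.range p) ω)⁻¹) P ∧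
    (v i - ∫ ω', X i ω' ∂P) * ∫ ω, (coordDist X v (Finset.range p) ω)⁻¹ ∂P
      = ∫ ω, (X i ω - ∫ ω', X i ω' ∂P) * (coordDist X v (Finset.range p) ω)⁻¹ ∂P := by
  obtain ⟨-, hint⟩ := h.integrable_inv_coordDist hp v
  have hint' := hint.const_mul (v i - ∫ ω', X i ω' ∂P)
  have e : (fun ω => (X i ω - ∫ ω', X i ω' ∂P) * (coordDist X v (Finset.range p) ω)⁻¹)
      = fun ω => (X i ω - v i) / coordDist X v (Finset.range p) ω
        + (v i - ∫ ω', X i ω' ∂P) * (coordDist X v (Finset.range p) ω)⁻¹ := by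
    funext ω
    ring
  rw [e]
  refine ⟨(hv.integrable_div i hi).add hint', ?_⟩
  rw [integral_add (hv.integrable_div i hi) hint', hv.integral_div i hi, zero_add,
    integral_const_mul]

/-- A bound of order one for `|v i - μ i|`, which the bound of order `1 / p` requires. -/
lemma InClassD.abs_sub_mean_le (h : InClassD P M q c σmin C X) (hq : 3 ≤ q) (hC : 1 ≤ C) {p : ℕ}
    (hp : 24 * (M + 1) ≤ p) {v : ℕ → ℝ} (hv : IsCriticalPoint P X p (1 + C) v) {i : ℕ}
    (hi : i < p) :
    |v i - ∫ ω', X i ω' ∂P| ≤ (1 + C) ^ 2 * (1 + invDistBound M c) := by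
  have hV : 0 < 1 + C := by linarith
  have hA := invDistBound_nonneg M c
  have hp0 : 0 < √(p : ℝ) := Real.sqrt_pos.2 (by exact_mod_cast (by omega : 0 < p))
  have hXi := h.measurable i
  obtain ⟨W, hW, hW0, hW3, hW3le, hdom, hind⟩ := h.exists_dominating_inv_dist hp hi v
  obtain ⟨hYi, hYeq⟩ := h.sub_mul_integral_inv hp hv hi
  have hlow := h.le_integral_inv_coordDist hp hV hv
  obtain ⟨hYint, hYle⟩ := h.centered_pow hq i (j := 1) (by norm_num)
  simp only [pow_one] at hYint hYle
  have hWint := integrable_of_integrable_pow_three hW hW0 hW3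
  have hI : IndepFun (fun ω => |X i ω - ∫ ω', X i ω' ∂P|) W P :=
    hind (fun x => |x i - ∫ ω', X i ω' ∂P|) (by fun_prop)
      (fun x y hxy => by simp only; rw [hxy i (by simp)])
  have hWle : ∫ ω, W ω ∂P ≤ (1 + invDistBound M c) / √p := by
    -- The inequality `x ≤ 1 + x ^ 3` for `x = W √p` bounds the first moment by the third.
    have h1 : ∫ ω, W ω ∂P ≤ ∫ ω, (1 / √p + √p ^ 2 * W ω ^ 3) ∂P := by
      refine integral_mono hWint ((integrable_const _).add (hW3.const_mul _)) fun ω => ?_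
      have hw : W ω * √p ≤ 1 + (W ω * √p) ^ 3 := by
        have := mul_nonneg (hW0 ω) hp0.le
        nlinarith [sq_nonneg (W ω * √p - 1), mul_nonneg this (sq_nonneg (W ω * √p - 1))]
      have e : 1 / √p + √p ^ 2 * W ω ^ 3 = (1 + (W ω * √p) ^ 3) / √p := by field_simp
      simp only
      rw [e, le_div_iff₀ hp0]
      exact hw
    rw [integral_add (integrable_const _) (hW3.const_mul _), integral_const_mul] at h1
    simp only [integral_const, probReal_univ, one_smul] at h1
    have h2 : √(p : ℝ) ^ 2 * ∫ ω, W ω ^ 3 ∂P ≤ √p ^ 2 * (invDistBound M c / √p ^ 3) := by gcongr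
    have h3 : √(p : ℝ) ^ 2 * (invDistBound M c / √p ^ 3) = invDistBound M c / √p := by field_simp
    rw [add_div]
    linarith
  have hprod : Integrable (fun ω => |X i ω - ∫ ω', X i ω' ∂P| * W ω) P :=
    hI.integrable_mul hYint hWint
  have hub : |∫ ω, (X i ω - ∫ ω', X i ω' ∂P) * (coordDist X v (Finset.range p) ω)⁻¹ ∂P|
      ≤ (1 + C) * ((1 + invDistBound M c) / √p) := by
    calc |∫ ω, (X i ω - ∫ ω', X i ω' ∂P) * (coordDist X v (Finset.range p) ω)⁻¹ ∂P|
        ≤ ∫ ω, |X i ω - ∫ ω', X i ω' ∂P| * W ω ∂P := by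
          rw [← Real.norm_eq_abs]
          refine norm_integral_le_of_norm_le hprod ?_
          filter_upwards [hdom] with ω hω
          rw [Real.norm_eq_abs, abs_mul, abs_of_nonneg (inv_nonneg.2 (coordDist_nonneg _ _ _ _))]
          gcongr
          exact (inv_anti₀ hω.1 (coordDist_mono X v (farIndices_subset M p i) ω)).trans hω.2
      _ = (∫ ω, |X i ω - ∫ ω', X i ω' ∂P| ∂P) * ∫ ω, W ω ∂P :=
          hI.integral_fun_mul_eq_mul_integral hYint.aestronglyMeasurable hWint.aestronglyMeasurable
      _ ≤ _ := mul_le_mul hYle hWle (integral_nonneg hW0) hV.le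
  rw [← hYeq, abs_mul] at hub
  have hmul : |v i - ∫ ω', X i ω' ∂P| * (1 / ((1 + C) * √p))
      ≤ (1 + C) * ((1 + invDistBound M c) / √p) :=
    (mul_le_mul_of_nonneg_left (hlow.trans (le_abs_self _)) (abs_nonneg _)).trans hub
  rw [mul_one_div, div_le_iff₀ (by positivity)] at hmul
  refine hmul.trans (le_of_eq ?_)
  field_simp

lemma nearIndices_card_le (M p i : ℕ) : (nearIndices M p i).card ≤ 2 * M + 1 := by
  have : nearIndices M p i ⊆ Finset.Icc (i - M) (i + M) := by
    intro j hj
    have := (Finset.mem_filter.1 hj).2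
    rw [Finset.mem_Icc]
    omega
  refine (Finset.card_le_card this).trans ?_
  rw [Nat.card_Icc]
  omega

/-- The contribution of the coordinates near `i`: a third-order moment, bounded because `v` stays
within `Δ` of the means. -/
lemma InClassD.integral_abs_mul_near_le (h : InClassD P M q c σmin C X) (hq : 3 ≤ q) (hC : 1 ≤ C)
    {p : ℕ} {v : ℕ → ℝ} {Δ : ℝ} (hΔ : ∀ j < p, |v j - ∫ ω', X j ω' ∂P| ≤ Δ) (i : ℕ) :
    Integrable (fun ω => |X i ω - ∫ ω', X i ω' ∂P| *
      ∑ j ∈ nearIndices M p i, (X j ω - v j) ^ 2) P ∧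
    ∫ ω, |X i ω - ∫ ω', X i ω' ∂P| * ∑ j ∈ nearIndices M p i, (X j ω - v j) ^ 2 ∂P
      ≤ (2 * M + 1) * ((1 + C) * (4 + 2 * Δ ^ 2)) := by
  have hV : 0 < 1 + C := by linarith
  have hX := h.measurable
  let g (j : ℕ) (ω : Ω) : ℝ := 2 * |X i ω - ∫ ω', X i ω' ∂P| ^ 3
    + 2 * |X j ω - ∫ ω', X j ω' ∂P| ^ 3 + 2 * Δ ^ 2 * |X i ω - ∫ ω', X i ω' ∂P| ^ 1
  have hg (j : ℕ) : Integrable (g j) P :=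
    (((h.centered_pow hq i le_rfl).1.const_mul 2).add
      ((h.centered_pow hq j le_rfl).1.const_mul 2)).add
      ((h.centered_pow hq i (by norm_num)).1.const_mul (2 * Δ ^ 2))
  have hgle (j : ℕ) : ∫ ω, g j ω ∂P ≤ (1 + C) * (4 + 2 * Δ ^ 2) := by
    have h1 := (h.centered_pow hq i le_rfl)
    have h2 := (h.centered_pow hq j le_rfl)
    have h3 := (h.centered_pow hq i (j := 1) (by norm_num))
    have hadd : Integrable (fun ω => 2 * |X i ω - ∫ ω', X i ω' ∂P| ^ 3
      + 2 * |X j ω - ∫ ω', X j ω' ∂P| ^ 3) P := (h1.1.const_mul 2).add (h2.1.const_mul 2)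
    simp only [g]
    rw [integral_add hadd (h3.1.const_mul _), integral_add (h1.1.const_mul 2) (h2.1.const_mul 2),
      integral_const_mul, integral_const_mul, integral_const_mul]
    have := mul_le_mul_of_nonneg_left h3.2 (by positivity : 0 ≤ 2 * Δ ^ 2)
    linarith [h1.2, h2.2]
  have hpt (j : ℕ) (hj : j < p) (ω : Ω) :
      |X i ω - ∫ ω', X i ω' ∂P| * (X j ω - v j) ^ 2 ≤ g j ω := by
    set a := |X i ω - ∫ ω', X i ω' ∂P|
    set b := |X j ω - ∫ ω', X j ω' ∂P| with hb
    have ha0 : 0 ≤ a := abs_nonneg _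
    have hb0 : 0 ≤ b := abs_nonneg _
    have hd : (v j - ∫ ω', X j ω' ∂P) ^ 2 ≤ Δ ^ 2 := by
      rw [← sq_abs (v j - _)]
      exact pow_le_pow_left₀ (abs_nonneg _) (hΔ j hj) 2
    have hs : (X j ω - v j) ^ 2 ≤ 2 * b ^ 2 + 2 * Δ ^ 2 := by
      rw [hb, sq_abs]
      nlinarith [sq_nonneg ((X j ω - ∫ ω', X j ω' ∂P) + (v j - ∫ ω', X j ω' ∂P))]
    have hab : a * b ^ 2 ≤ a ^ 3 + b ^ 3 := by
      rcases le_total a b with hle | hle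
      · nlinarith [mul_le_mul_of_nonneg_right hle (sq_nonneg b), pow_nonneg ha0 3]
      · nlinarith [mul_le_mul_of_nonneg_left (pow_le_pow_left₀ hb0 hle 2) ha0, pow_nonneg hb0 3]
    have := mul_le_mul_of_nonneg_left hs ha0
    simp only [g, pow_one]
    nlinarith
  have hpt' (ω : Ω) : |X i ω - ∫ ω', X i ω' ∂P| * ∑ j ∈ nearIndices M p i, (X j ω - v j) ^ 2
      ≤ ∑ j ∈ nearIndices M p i, g j ω := by
    rw [Finset.mul_sum]
    exact Finset.sum_le_sum fun j hj =>
      hpt j (Finset.mem_range.1 (Finset.mem_filter.1 hj).1) ω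
  have hgs : Integrable (fun ω => ∑ j ∈ nearIndices M p i, g j ω) P :=
    integrable_finsetSum _ fun j _ => hg j
  have hint : Integrable (fun ω => |X i ω - ∫ ω', X i ω' ∂P| *
      ∑ j ∈ nearIndices M p i, (X j ω - v j) ^ 2) P := by
    refine hgs.mono' (by fun_prop) (Filter.Eventually.of_forall fun ω => ?_)
    rw [Real.norm_of_nonneg
      (mul_nonneg (abs_nonneg _) (Finset.sum_nonneg fun _ _ => sq_nonneg _))]
    exact hpt' ω
  refine ⟨hint, (integral_mono hint hgs hpt').trans ?_⟩
  rw [integral_finsetSum _ fun j _ => hg j]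
  refine (Finset.sum_le_card_nsmul _ _ _ fun j _ => hgle j).trans ?_
  rw [nsmul_eq_mul]
  gcongr
  exact_mod_cast nearIndices_card_le M p i

lemma inv_sub_inv_le {r s d w : ℝ} (hs : 0 < s) (hsr : s ≤ r) (hd : r ^ 2 = s ^ 2 + d)
    (hw : s⁻¹ ≤ w) : |r⁻¹ - s⁻¹| ≤ d * w ^ 3 := by
  have hr : 0 < r := hs.trans_le hsr
  have hd0 : 0 ≤ d := by nlinarith
  have e : s⁻¹ - r⁻¹ = d / (r * s * (r + s)) := by
    field_simp
    linarith
  have h1 : d / (r * s * (r + s)) ≤ d * s⁻¹ ^ 3 := by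
    rw [inv_pow, ← div_eq_mul_inv]
    refine div_le_div_of_nonneg_left hd0 (by positivity) ?_
    calc s ^ 3 = s * s * s := by ring
      _ ≤ r * s * (r + s) := by gcongr; linarith
  rw [abs_sub_comm, e, abs_of_nonneg (by positivity)]
  exact h1.trans (by gcongr)

/-- Replacing the distance by the distance in the far coordinates, which is independent of `X i`,
makes the right-hand side of the first-order condition vanish; the error is of order
`p ^ (-3/2)`. -/
lemma InClassD.abs_sub_mean_le_div (h : InClassD P M q c σmin C X) (hq : 3 ≤ q) (hC : 1 ≤ C)
    {p : ℕ} (hp : 24 * (M + 1) ≤ p) {v : ℕ → ℝ} (hv : IsCriticalPoint P X p (1 + C) v)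
    {Δ : ℝ} (hΔ : ∀ j < p, |v j - ∫ ω', X j ω' ∂P| ≤ Δ) {i : ℕ} (hi : i < p) :
    |v i - ∫ ω', X i ω' ∂P|
      ≤ (1 + C) * ((2 * M + 1) * ((1 + C) * (4 + 2 * Δ ^ 2)) * invDistBound M c) / p := by
  have hV : 0 < 1 + C := by linarith
  have hA := invDistBound_nonneg M c
  have hp00 : (0 : ℝ) < p := by exact_mod_cast (by omega : 0 < p)
  have hp0 : 0 < √(p : ℝ) := Real.sqrt_pos.2 hp00
  have hX := h.measurable
  obtain ⟨W, hW, hW0, hW3, hW3le, hdom, hind⟩ := h.exists_dominating_inv_dist hp hi v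
  obtain ⟨hYi, hYeq⟩ := h.sub_mul_integral_inv hp hv hi
  have hlow := h.le_integral_inv_coordDist hp hV hv
  obtain ⟨hNint, hNle⟩ := h.integral_abs_mul_near_le hq hC hΔ i (M := M)
  have hWint := integrable_of_integrable_pow_three hW hW0 hW3
  have hYint : Integrable (fun ω => X i ω - ∫ ω', X i ω' ∂P) P :=
    (h.integrable hq i).sub (integrable_const _)
  have hfar_int : Integrable (fun ω => (coordDist X v (farIndices M p i) ω)⁻¹) P := by
    refine hWint.mono' (measurable_coordDist hX v _).inv.aestronglyMeasurable ?_
    filter_upwards [hdom] with ω hω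
    rw [Real.norm_of_nonneg (inv_nonneg.2 (coordDist_nonneg _ _ _ _))]
    exact hω.2
  have hIfar : IndepFun (fun ω => X i ω - ∫ ω', X i ω' ∂P)
      (fun ω => (coordDist X v (farIndices M p i) ω)⁻¹) P := by
    have := h.mDependent.indepFun_apply_of_dependsOn hX i
      (ψ := fun x => (√(∑ j ∈ farIndices M p i, (x j - v j) ^ 2))⁻¹) (by fun_prop) (by
        intro x y hxy
        simp only
        congr 2
        refine Finset.sum_congr rfl fun j hj => ?_
        rw [hxy j (Finset.mem_filter.1 hj).2])
    exact this.comp (measurable_id.sub_const _) measurable_id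
  have hfar0 : ∫ ω, (X i ω - ∫ ω', X i ω' ∂P) * (coordDist X v (farIndices M p i) ω)⁻¹ ∂P = 0 := by
    rw [hIfar.integral_fun_mul_eq_mul_integral hYint.aestronglyMeasurable
      hfar_int.aestronglyMeasurable, integral_sub (h.integrable hq i) (integrable_const _)]
    simp
  have hfar_prod : Integrable
      (fun ω => (X i ω - ∫ ω', X i ω' ∂P) * (coordDist X v (farIndices M p i) ω)⁻¹) P :=
    hIfar.integrable_mul hYint hfar_int
  have hInear : IndepFun (fun ω => |X i ω - ∫ ω', X i ω' ∂P| *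
      ∑ j ∈ nearIndices M p i, (X j ω - v j) ^ 2) (fun ω => W ω ^ 3) P := by
    have := hind (fun x => |x i - ∫ ω', X i ω' ∂P| * ∑ j ∈ nearIndices M p i, (x j - v j) ^ 2)
      (by fun_prop) (by
        intro x y hxy
        simp only
        rw [hxy i (by simp)]
        congr 1
        refine Finset.sum_congr rfl fun j hj => ?_
        have := (Finset.mem_filter.1 hj).2
        rw [hxy j (by simp only [Set.mem_ofPred_eq]; omega)])
    exact this.comp measurable_id (measurable_id.pow_const 3)
  have hprod : Integrable (fun ω => |X i ω - ∫ ω', X i ω' ∂P| *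
      (∑ j ∈ nearIndices M p i, (X j ω - v j) ^ 2) * W ω ^ 3) P :=
    hInear.integrable_mul hNint hW3
  have hub : |∫ ω, (X i ω - ∫ ω', X i ω' ∂P) * (coordDist X v (Finset.range p) ω)⁻¹ ∂P|
      ≤ (2 * M + 1) * ((1 + C) * (4 + 2 * Δ ^ 2)) * (invDistBound M c / √p ^ 3) := by
    rw [← sub_zero (∫ ω, (X i ω - ∫ ω', X i ω' ∂P) * (coordDist X v (Finset.range p) ω)⁻¹ ∂P),
      ← hfar0, ← integral_sub hYi hfar_prod]
    calc |∫ ω, ((X i ω - ∫ ω', X i ω' ∂P) * (coordDist X v (Finset.range p) ω)⁻¹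
            - (X i ω - ∫ ω', X i ω' ∂P) * (coordDist X v (farIndices M p i) ω)⁻¹) ∂P|
        ≤ ∫ ω, |X i ω - ∫ ω', X i ω' ∂P| *
          (∑ j ∈ nearIndices M p i, (X j ω - v j) ^ 2) * W ω ^ 3 ∂P := by
          rw [← Real.norm_eq_abs]
          refine norm_integral_le_of_norm_le hprod ?_
          filter_upwards [hdom] with ω hω
          rw [Real.norm_eq_abs, ← mul_sub, abs_mul, mul_assoc]
          refine mul_le_mul_of_nonneg_left (inv_sub_inv_le hω.1
            (coordDist_mono X v (farIndices_subset M p i) ω) ?_ hω.2) (abs_nonneg _)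
          rw [coordDist_sq, coordDist_sq]
          exact (Finset.sum_filter_add_sum_filter_not _ _ _).symm
      _ = _ := hInear.integral_fun_mul_eq_mul_integral hNint.aestronglyMeasurable
          hW3.aestronglyMeasurable
      _ ≤ _ := mul_le_mul hNle hW3le (integral_nonneg fun ω => pow_nonneg (hW0 ω) 3)
          (by positivity)
  rw [← hYeq, abs_mul] at hub
  have hmul := (mul_le_mul_of_nonneg_left (hlow.trans (le_abs_self _))
    (abs_nonneg (v i - ∫ ω', X i ω' ∂P))).trans hub
  rw [mul_one_div, div_le_iff₀ (by positivity)] at hmul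
  refine hmul.trans (le_of_eq ?_)
  have hsq : (p : ℝ) = √p ^ 2 := (Real.sq_sqrt hp00.le).symm
  conv_rhs => rw [hsq]
  field_simp

end

/-! ### The distance from the median to the mean -/

/-- The constant of the theorem. The first summand is the bound for `p ≥ 24 (M + 1)`, the second
serves the finitely many smaller values of `p`. -/
noncomputable def medianMeanConst (M : ℕ) (c C : ℝ) : ℝ :=
  (1 + C) * ((2 * M + 1) * ((1 + C) * (4 + 2 * ((1 + C) ^ 2 * (1 + invDistBound M c)) ^ 2))
    * invDistBound M c) + 2 * (1 + C) * (24 * (M + 1)) ^ 2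

/-- A vector with `p` coordinates, continued by zeros to a sequence. -/
def extendByZero {p : ℕ} (m : EuclideanSpace ℝ (Fin p)) (j : ℕ) : ℝ :=
  if h : j < p then m ⟨j, h⟩ else 0

lemma extendByZero_val {p : ℕ} (m : EuclideanSpace ℝ (Fin p)) (i : Fin p) :
    extendByZero m i = m i := by
  simp [extendByZero]

lemma norm_firstTerms_sub {Ω : Type*} {X : ℕ → Ω → ℝ} {p : ℕ} (m : EuclideanSpace ℝ (Fin p)) (ω : Ω) :
    ‖firstTerms X p ω - m‖ = coordDist X (extendByZero m) (Finset.range p) ω := by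
  rw [EuclideanSpace.norm_eq, coordDist,
    ← Fin.sum_univ_eq_sum_range (fun j => (X j ω - extendByZero m j) ^ 2)]
  simp only [extendByZero_val, Real.norm_eq_abs, sq_abs]
  rfl

section

variable {Ω : Type*} [MeasurableSpace Ω] {P : Measure Ω} [IsProbabilityMeasure P] {M : ℕ}
  {q c σmin C : ℝ} {X : ℕ → Ω → ℝ}

lemma InClassD.isCriticalPoint (h : InClassD P M q c σmin C X) (hq : 3 ≤ q) (hC : 1 ≤ C) {p : ℕ}
    (hp : 1 ≤ p) {m : EuclideanSpace ℝ (Fin p)} (hm : IsGeometricMedian P (firstTerms X p) m) :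
    IsCriticalPoint P X p (1 + C) (extendByZero m) := by
  have hY := h.integrable_firstTerms hq p
  have hne : ∀ᵐ ω ∂P, firstTerms X p ω ≠ m := by
    filter_upwards [h.ae_ne 0 (m ⟨0, hp⟩)] with ω hω heq
    exact hω (congrArg (fun x : EuclideanSpace ℝ (Fin p) => x ⟨0, hp⟩) heq)
  have hfoc (i : ℕ) (hi : i < p) := hm.integral_div_norm_eq_zero hY hne ⟨i, hi⟩
  have hv (i : ℕ) (hi : i < p) : m ⟨i, hi⟩ = extendByZero m i := by simp [extendByZero, hi]
  simp only [norm_firstTerms_sub, hv] at hfoc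
  refine ⟨?_, ?_, fun i hi => (hfoc i hi).1, fun i hi => (hfoc i hi).2⟩
  · have hi : Integrable (fun ω => ‖firstTerms X p ω - m‖) P :=
      (hY.sub (integrable_const m)).norm
    simpa only [norm_firstTerms_sub] using hi
  · simpa only [norm_firstTerms_sub] using
      (hm (meanVector P X p)).trans (h.integral_norm_sub_meanVector_le hq hC hp)

/-- The triangle inequality bounds the distance from a median to the mean by twice the expected
distance to the mean; this suffices for bounded `p`. -/
lemma InClassD.norm_sub_meanVector_le (h : InClassD P M q c σmin C X) (hq : 3 ≤ q) (hC : 1 ≤ C)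
    {p : ℕ} (hp : 1 ≤ p) {m : EuclideanSpace ℝ (Fin p)}
    (hm : IsGeometricMedian P (firstTerms X p) m) :
    ‖m - meanVector P X p‖ ≤ 2 * ((1 + C) * √p) := by
  have hint (v : EuclideanSpace ℝ (Fin p)) : Integrable (fun ω => ‖firstTerms X p ω - v‖) P :=
    ((h.integrable_firstTerms hq p).sub (integrable_const v)).norm
  have h1 : ∫ _, ‖m - meanVector P X p‖ ∂P
      ≤ ∫ ω, (‖firstTerms X p ω - m‖ + ‖firstTerms X p ω - meanVector P X p‖) ∂P := by
    refine integral_mono (integrable_const _) ((hint _).add (hint _)) fun ω => ?_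
    have e : m - meanVector P X p
        = (firstTerms X p ω - meanVector P X p) - (firstTerms X p ω - m) := by abel
    simp only
    rw [e, add_comm]
    exact norm_sub_le _ _
  rw [integral_add (hint _) (hint _)] at h1
  simp only [integral_const, probReal_univ, one_smul] at h1
  have h2 := hm (meanVector P X p)
  have h3 := h.integral_norm_sub_meanVector_le hq hC hp
  linarith

lemma InClassD.abs_sub_meanVector_le (h : InClassD P M q c σmin C X) (hq : 3 ≤ q) (hC : 1 ≤ C)
    {p : ℕ} (hp : 1 ≤ p) {m : EuclideanSpace ℝ (Fin p)}
    (hm : IsGeometricMedian P (firstTerms X p) m) (i : Fin p) :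
    |m i - meanVector P X p i| ≤ medianMeanConst M c C / p := by
  have hA := invDistBound_nonneg M c
  have hV : 0 < 1 + C := by linarith
  have hp1 : (1 : ℝ) ≤ p := by exact_mod_cast hp
  rcases le_or_gt (24 * (M + 1)) p with hlarge | hsmall
  · have hv := h.isCriticalPoint hq hC hp hm
    have := h.abs_sub_mean_le_div hq hC hlarge hv
      (fun j hj => h.abs_sub_mean_le hq hC hlarge hv hj) i.2
    rw [extendByZero_val] at this
    refine this.trans ?_
    unfold medianMeanConst
    gcongr
    exact le_add_of_nonneg_right (by positivity)
  · have h1 : |m i - meanVector P X p i| ≤ ‖m - meanVector P X p‖ :=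
      PiLp.norm_apply_le (m - meanVector P X p) i
    have h2 := h.norm_sub_meanVector_le hq hC hp hm
    have h3 : √(p : ℝ) ≤ p := Real.sqrt_le_left (by positivity) |>.2 (by nlinarith)
    have h4 : (p : ℝ) ≤ 24 * (M + 1) := by exact_mod_cast hsmall.le
    rw [le_div_iff₀ (by positivity)]
    calc |m i - meanVector P X p i| * p ≤ 2 * ((1 + C) * p) * p := by
          have : 2 * ((1 + C) * √(p : ℝ)) ≤ 2 * ((1 + C) * p) := by gcongr
          gcongr
          linarith
      _ = 2 * (1 + C) * (p : ℝ) ^ 2 := by ring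
      _ ≤ 2 * (1 + C) * (24 * (M + 1)) ^ 2 := by gcongr
      _ ≤ medianMeanConst M c C := le_add_of_nonneg_left (by positivity)

end

lemma norm_le_div_sqrt_of_abs_le_div {p : ℕ} (hp : 1 ≤ p) {x : EuclideanSpace ℝ (Fin p)} {B : ℝ}
    (hB : 0 ≤ B) (hx : ∀ i, |x i| ≤ B / p) : ‖x‖ ≤ B / √p := by
  have hp0 : (0 : ℝ) < p := by exact_mod_cast hp
  rw [EuclideanSpace.norm_eq]
  refine Real.sqrt_le_iff.2 ⟨by positivity, ?_⟩
  calc ∑ i, ‖x i‖ ^ 2 ≤ ∑ _i : Fin p, (B / p) ^ 2 :=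
        Finset.sum_le_sum fun i _ => pow_le_pow_left₀ (norm_nonneg _) (hx i) 2
    _ = (B / √p) ^ 2 := by
        rw [div_pow B, div_pow B, Real.sq_sqrt hp0.le]
        simp
        field_simp

theorem mainTheorem1 (M : ℕ) (q c σmin C : ℝ)
    (hq : 3 ≤ q) (hc : 0 < c) (hσ : 0 < σmin) (hC : 1 ≤ C) :
    ∃ B₃ : ℝ, ∀ (Ω : Type*) [MeasurableSpace Ω] (P : Measure Ω) [IsProbabilityMeasure P]
      (X : ℕ → Ω → ℝ), InClassD P M q c σmin C X →
      ∀ p : ℕ, 1 ≤ p →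
        (∃ m : EuclideanSpace ℝ (Fin p), IsGeometricMedian P (firstTerms X p) m) ∧
        (M + 2 ≤ p → ∃! m : EuclideanSpace ℝ (Fin p), IsGeometricMedian P (firstTerms X p) m) ∧
        ∀ m : EuclideanSpace ℝ (Fin p), IsGeometricMedian P (firstTerms X p) m →
          (∀ i : Fin p, |m i - meanVector P X p i| ≤ B₃ / (p : ℝ)) ∧
          ‖m - meanVector P X p‖ ≤ B₃ / Real.sqrt (p : ℝ) := by
  refine ⟨medianMeanConst M c C, fun Ω _ P _ X h p hp => ?_⟩
  have hY := h.integrable_firstTerms hq p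
  obtain ⟨m, hm⟩ := exists_isGeometricMedian hY
  have hA := invDistBound_nonneg M c
  have hB : 0 ≤ medianMeanConst M c C := by
    have hV : 0 < 1 + C := by linarith
    unfold medianMeanConst
    positivity
  refine ⟨⟨m, hm⟩, fun hp2 => ⟨m, hm, fun m' hm' => hm'.eq_of_ae_not_sameRay hY hm
    fun hne => h.ae_not_sameRay hp2 hne⟩, fun m' hm' => ?_⟩
  have hcoord (i : Fin p) := h.abs_sub_meanVector_le hq hC hp hm' i
  exact ⟨hcoord, norm_le_div_sqrt_of_abs_le_div hp hB hcoord⟩
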